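/- Let $X$ be a Polish space, $E$ a countable Borel equivalence relation on $X$ (a Borel equivalence relation all of whose classes are countable), $\Gamma$ a countable group, and $\mu$ a Borel probability measure on $X$. A sequence $(F_r)_{r\in\mathbb R}$ of subequivalence relations of $E$ is a *stratification* of $E$ if for all reals $r<s$ every $F_r$-class is properly contained in an $F_s$-class. It is a *$\mu$-stratification* if, moreover, for every Borel set $B$ with $\mu(B)>0$ and all $r<s$, for $\mu$-almost every $x\in B$ the $(F_r\restriction B)$-class of $x$ is properly contained in an $(F_s\restriction B)$-class. It is *Borel* if $\{(r,x,y) : x\mathrel{F_r}y\}$ is a Borel subset of $\mathbb R\times X\times X$. A sequence $(\cdot_r)_{r\in\mathbb R}$ of actions of $\Gamma$ on $X$ is *Borel* if $\{(r,\gamma,x,y) : \gamma\cdot_r x=y\}$ is a Borel subset of $\mathbb R\times\Gamma\times X\times X$ ($\Gamma$ discrete), and it is a ($\mu$-)stratification of $E$ if the sequence of its orbit equivalence relations is one. Suppose that $(E_r)_{r\in\mathbb R}$ is a Borel $\mu$-stratification of $E$ such that each $E_r$ is the orbit equivalence relation of a free Borel action of $\Gamma$ on $X$. Then there are a Borel sequence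 $(\cdot_r)_{r\in\mathbb R}$ of free Borel actions of $\Gamma$ on $X$, whose orbit equivalence relations form an increasing sequence of subequivalence relations of $E$, a Borel function $\pi\colon\mathbb R\to\mathbb R$, and an $E$-invariant $\mu$-conull Borel set $C\subseteq X$ such that the restrictions of the actions $\cdot_r$ to $C$ form a Borel $\mu$-stratification of $E\restriction C$ and, for every $r\in\mathbb R$, the equivalence relation generated by $\cdot_r$ on $C$ is $E_{\pi(r)}\restriction C$. -/

import Mathlib

open MeasureTheory

namespace BorelStrat

/-- The equivalence class of `x` under `E`. -/
def cls {X : Type*} (E : Setoid X) (x : X) : Set X := {y | E.r x y}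

/-- Countable Borel equivalence relation: Borel as a subset of `X × X`, all classes countable. -/
structure IsCountableBorel {X : Type*} [MeasurableSpace X] (E : Setoid X) : Prop where
  borel : MeasurableSet {p : X × X | E.r p.1 p.2}
  countable : ∀ x, (cls E x).Countable

/-- `C` is a union of `E`-classes. -/
def IsInvariant {X : Type*} (E : Setoid X) (C : Set X) : Prop :=
  ∀ x ∈ C, ∀ y, E.r x y → y ∈ C

/-- The restriction of an equivalence relation to a subset, as a relation on the subtype. -/
def restr {X : Type*} (E : Setoid X) (C : Set X) : Setoid C :=
  E.comap Subtype.val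

/-- The sequence `F` of subequivalence relations is a stratification of `E`. -/
structure IsStratification {X : Type*} (E : Setoid X) (F : ℝ → Setoid X) : Prop where
  sub : ∀ r, F r ≤ E
  ssubset : ∀ r s : ℝ, r < s → ∀ x, cls (F r) x ⊂ cls (F s) x

/-- A stratification is a `μ`-stratification if moreover the inclusions remain proper almost
everywhere on each `μ`-positive Borel set after restricting the relations to this set. -/
structure IsMuStratification {X : Type*} [MeasurableSpace X] (μ : Measure X)
    (E : Setoid X) (F : ℝ → Setoid X) : Prop extends IsStratification E F where
  ae_ssubset : ∀ B : Set X, MeasurableSet B → 0 < μ B → ∀ r s : ℝ, r < s →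
    ∀ᵐ x ∂(μ.restrict B), cls (F r) x ∩ B ⊂ cls (F s) x ∩ B

/-- A sequence of equivalence relations is Borel as a sequence of subsets of `X × X`. -/
def IsBorelRelSeq {X : Type*} [MeasurableSpace X] (F : ℝ → Setoid X) : Prop :=
  MeasurableSet {p : ℝ × (X × X) | (F p.1).r p.2.1 p.2.2}

/-- The point `γ · x` for the action `a`. -/
def act {Γ X : Type*} [Group Γ] (a : MulAction Γ X) (γ : Γ) (x : X) : X :=
  letI := a
  γ • x

/-- The orbit equivalence relation generated by the action `a`. -/
def orb {Γ X : Type*} [Group Γ] (a : MulAction Γ X) : Setoid X :=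
  @MulAction.orbitRel Γ X _ a

/-- Freeness: only the identity has fixed points. -/
def IsFreeAct {Γ X : Type*} [Group Γ] (a : MulAction Γ X) : Prop :=
  ∀ (γ : Γ) (x : X), act a γ x = x → γ = 1

/-- Borel action of a countable discrete group. -/
def IsBorelAct {Γ X : Type*} [Group Γ] [MeasurableSpace X] (a : MulAction Γ X) : Prop :=
  ∀ γ : Γ, Measurable (act a γ)

/-- The graphs of the actions form a Borel sequence of subsets of `(Γ × X) × X`. -/
def IsBorelActSeq {Γ X : Type*} [Group Γ] [MeasurableSpace Γ] [MeasurableSpace X]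
    (a : ℝ → MulAction Γ X) : Prop :=
  MeasurableSet {p : ℝ × ((Γ × X) × X) | act (a p.1) p.2.1.1 p.2.1.2 = p.2.2}

end BorelStrat

/-! Choose, with no regularity in r, a free Borel action A_r generating E_r. Relative to Borel
functions h_j enumerating the E-classes almost everywhere, A_r is coded by countably many measurable
functions to ℕ: for each k the first j with γ_k ·_r x = h_j(x), and for each j the first k with this
property. Measurable functions to ℕ form a separable space under convergence in measure, so
uncountably many parameters r must have codes close to one another (`exists_code`).

This yields a Cantor scheme of nested intervals [l_v, u_v], v a finite binary word, along which the
codes at the endpoints change by summable amounts. By Borel–Cantelli, at almost every x each code is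
eventually constant along every branch, with the same value at lower and upper endpoints
(`exists_interval_scheme_ae`).

A real r determines the branch given by its cut in the rationals, a point π(r) of all intervals on
that branch, and a limit action of the A_{l_v}. Its orbits lie in the classes of E_{π(r)} since l_v
≤ π(r). Conversely, an E_{π(r)}-related pair is related at every u_v; the second kind of code names
one group element that realizes it at all deep l_v, hence in the limit. Freeness passes to the
limit, Borelness in r holds because only countably many actions A_{l_v} occur, and π is strictly
increasing, so properness of inclusions is inherited.

The almost everywhere statements hold on an E-invariant Borel set C after replacing μ by a
quasi-invariant measure; off C every action is A_0. -/

namespace BorelStrat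

/-! ### Almost everywhere uniformization of Borel sets with countable sections -/

section LusinNovikov

open Set Filter Topology PiNat

variable {X : Type*} [MeasurableSpace X]

/-- Over almost every point, the part of `A` in the fibre of `p` has its `q`-image covered by
the values of countably many measurable functions. -/
def FibresCovered {Z : Type*} (ν : Measure X) (p : Z → X) (q : Z → ℝ) (A : Set Z) : Prop :=
  ∃ g : ℕ → X → ℝ, (∀ i, Measurable (g i)) ∧ ∀ᵐ x ∂ν, ∀ z ∈ A, p z = x → ∃ i, q z = g i x

variable {Z : Type*} {ν : Measure X} {p : Z → X} {q : Z → ℝ}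

theorem FibresCovered.mono {A B : Set Z} (hB : FibresCovered ν p q B) (h : A ⊆ B) :
    FibresCovered ν p q A := by
  obtain ⟨g, hg, hx⟩ := hB
  exact ⟨g, hg, hx.mono fun x hx z hz => hx z (h hz)⟩

theorem FibresCovered.of_graph {A : Set Z} {g : X → ℝ} (hg : Measurable g)
    (h : ∀ z ∈ A, q z = g (p z)) : FibresCovered ν p q A :=
  ⟨fun _ => g, fun _ => hg, Eventually.of_forall fun x z hz hx => ⟨0, by rw [h z hz, hx]⟩⟩

theorem FibresCovered.empty : FibresCovered ν p q ∅ :=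
  FibresCovered.of_graph (g := fun _ => 0) measurable_const (by simp)

theorem FibresCovered.iUnion {ι : Type*} [Countable ι] {A : ι → Set Z}
    (h : ∀ i, FibresCovered ν p q (A i)) : FibresCovered ν p q (⋃ i, A i) := by
  rcases isEmpty_or_nonempty ι with hι | hι
  · rw [iUnion_of_empty]
    exact FibresCovered.empty
  choose g hg hx using h
  obtain ⟨e, he⟩ := exists_surjective_nat (ι × ℕ)
  refine ⟨fun n => g (e n).1 (e n).2, fun n => hg _ _, ?_⟩
  filter_upwards [ae_all_iff.2 hx] with x hx z hz hzx
  obtain ⟨i, hi⟩ := mem_iUnion.1 hz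
  obtain ⟨j, hj⟩ := hx i z hi hzx
  obtain ⟨n, hn⟩ := he (i, j)
  exact ⟨n, by rw [hn]; exact hj⟩

theorem FibresCovered.union {A B : Set Z} (hA : FibresCovered ν p q A)
    (hB : FibresCovered ν p q B) : FibresCovered ν p q (A ∪ B) := by
  rw [union_eq_iUnion]
  exact FibresCovered.iUnion fun b => by cases b <;> assumption

theorem FibresCovered.of_measure_zero {A : Set Z} {D : Set X} (hD : ν D = 0) :
    FibresCovered ν p q (A ∩ p ⁻¹' D) := by
  refine ⟨fun _ _ => 0, fun _ => measurable_const, ?_⟩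
  filter_upwards [measure_eq_zero_iff_ae_notMem.1 hD] with x hx z hz hzx
  exact absurd (hzx ▸ hz.2) hx

/-- There is an almost everywhere smallest measurable set outside of which the fibres of `A`
are covered. -/
theorem exists_uncovered_set [IsFiniteMeasure ν] (A : Set Z) :
    ∃ B : Set X, MeasurableSet B ∧ FibresCovered ν p q (A ∩ p ⁻¹' Bᶜ) ∧
      ∀ D : Set X, MeasurableSet D → FibresCovered ν p q (A ∩ p ⁻¹' D) → ν (D ∩ B) = 0 := by
  set S : Set (Set X) := {D | MeasurableSet D ∧ FibresCovered ν p q (A ∩ p ⁻¹' D)} with hS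
  have hne : (ν '' S).Nonempty :=
    ⟨_, ∅, ⟨MeasurableSet.empty, by simpa using FibresCovered.empty⟩, rfl⟩
  -- Exhaustion: the union of covered sets whose measures approach the supremum is a maximal covered
  -- set, and its complement is the set sought.
  obtain ⟨u, -, hu, huS⟩ := exists_seq_tendsto_sSup hne (OrderTop.bddAbove _)
  choose D hD hDu using huS
  set G := ⋃ n, D n with hG
  have hGm : MeasurableSet G := MeasurableSet.iUnion fun n => (hD n).1
  have hGc : FibresCovered ν p q (A ∩ p ⁻¹' G) := by
    rw [hG, preimage_iUnion, inter_iUnion]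
    exact FibresCovered.iUnion fun n => (hD n).2
  have hle : sSup (ν '' S) ≤ ν G :=
    le_of_tendsto' hu fun n => by rw [← hDu n]; exact measure_mono (subset_iUnion D n)
  refine ⟨Gᶜ, hGm.compl, by rwa [compl_compl], fun E hE hEc => ?_⟩
  have h1 : ν (G ∪ E) ≤ ν G := by
    have hmem : G ∪ E ∈ S := by
      refine ⟨hGm.union hE, ?_⟩
      rw [preimage_union, inter_union_distrib_left]
      exact hGc.union hEc
    exact (le_sSup (mem_image_of_mem ν hmem)).trans hle
  have h2 : ν (G ∪ E) = ν G + ν (E \ G) := by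
    rw [← union_sdiff_self, measure_union disjoint_sdiff_right (hE.diff hGm)]
  have h3 : ν G + ν (E \ G) ≤ ν G + 0 := by rw [← h2, add_zero]; exact h1
  have h4 := (ENNReal.add_le_add_iff_left (measure_ne_top ν G)).1 h3
  rw [← Set.sdiff_eq]
  exact le_antisymm h4 zero_le

/-- The points of Baire space with a given initial segment (listed backwards) and with `q`-value
in a given open interval. -/
def cell (q : (ℕ → ℕ) → ℝ) (s : List ℕ) (a b : ℚ) : Set (ℕ → ℕ) :=
  {z | res z s.length = s ∧ (a : ℝ) < q z ∧ q z < b}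

theorem cell_eq_iUnion (q : (ℕ → ℕ) → ℝ) (s : List ℕ) (a b : ℚ) :
    cell q s a b = ⋃ k, cell q (k :: s) a b := by
  ext z
  simp only [cell, mem_ofPred_eq, mem_iUnion, List.length_cons, res_succ, List.cons.injEq]
  exact ⟨fun ⟨h, h'⟩ => ⟨_, ⟨rfl, h⟩, h'⟩, fun ⟨_, ⟨_, h⟩, h'⟩ => ⟨h, h'⟩⟩

/-- The splitting step: where the cell is uncovered, two separated subcells are uncovered. -/
theorem ae_exists_split [IsFiniteMeasure ν] {p : (ℕ → ℕ) → X} {q : (ℕ → ℕ) → ℝ}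
    {B : List ℕ → ℚ → ℚ → Set X} (hBm : ∀ s a b, MeasurableSet (B s a b))
    (hBc : ∀ s a b, FibresCovered ν p q (cell q s a b ∩ p ⁻¹' (B s a b)ᶜ))
    (hB : ∀ s a b, ∀ D : Set X, MeasurableSet D →
      FibresCovered ν p q (cell q s a b ∩ p ⁻¹' D) → ν (D ∩ B s a b) = 0)
    (s : List ℕ) (a b : ℚ) :
    ∀ᵐ x ∂ν, x ∈ B s a b → ∃ a' b' : ℚ, a' < b' ∧ x ∈ B s a a' ∧ x ∈ B s b' b := by
  set W : Set X := ⋃ (c : ℚ × ℚ) (_ : c.1 < c.2), (B s a c.1 ∩ B s c.2 b) with hW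
  have hWm : MeasurableSet W := MeasurableSet.iUnion fun c => MeasurableSet.iUnion fun _ =>
    (hBm _ _ _).inter (hBm _ _ _)
  have key : FibresCovered ν p q (cell q s a b ∩ p ⁻¹' Wᶜ) := by
    classical
    -- The supremum `g` is the threshold above which the fibre is no longer uncovered. The default
    -- is at most `b`, for boundedness, and at most `a`, so that any value above `a` comes from a
    -- genuine `c`.
    set v : ℚ → X → ℝ := fun c x => if c < b ∧ x ∈ B s c b then (c : ℝ) else min a b with hv
    set g : X → ℝ := fun x => ⨆ c : ℚ, v c x with hg
    have hvm : ∀ c, Measurable (v c) := fun c => by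
      by_cases hc : c < b
      · simp only [hv, hc, true_and]
        exact Measurable.ite (hBm _ _ _) measurable_const measurable_const
      · simp only [hv, hc, false_and, if_false]
        exact measurable_const
    have hgm : Measurable g := Measurable.iSup hvm
    have hbdd : ∀ x, BddAbove (range fun c => v c x) := fun x => by
      refine ⟨b, ?_⟩
      rintro _ ⟨c, rfl⟩
      simp only [hv]
      split_ifs with h
      · exact_mod_cast h.1.le
      · exact min_le_right _ _
    have h1 : FibresCovered ν p q
        (⋃ c : ℚ, (cell q s a c ∩ p ⁻¹' (B s a c)ᶜ ∪ cell q s c b ∩ p ⁻¹' (B s c b)ᶜ)) :=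
      FibresCovered.iUnion fun c => (hBc _ _ _).union (hBc _ _ _)
    have h2 : FibresCovered ν p q {z | q z = g (p z)} :=
      FibresCovered.of_graph hgm fun z hz => hz
    refine (h1.union h2).mono ?_
    rintro z ⟨⟨hzs, hza, hzb⟩, hzW⟩
    -- Off `W`, values below the threshold are covered since there is an uncovered piece above them,
    -- values above it by its definition, and the threshold itself is a single graph.
    rcases lt_trichotomy (q z) (g (p z)) with hlt | heq | hgt
    · obtain ⟨a', ha', ha''⟩ := exists_rat_btwn hlt
      obtain ⟨c, hc⟩ := exists_lt_of_lt_ciSup ha''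
      have hcB : c < b ∧ p z ∈ B s c b ∧ a' < c := by
        simp only [hv] at hc
        split_ifs at hc with h
        · exact ⟨h.1, h.2, by exact_mod_cast hc⟩
        · have : (a : ℝ) < a := (hza.trans ha').trans (lt_of_lt_of_le hc (min_le_left _ _))
          exact absurd this (lt_irrefl _)
      left
      refine mem_iUnion.2 ⟨a', Or.inl ⟨⟨hzs, hza, ha'⟩, fun h => hzW ?_⟩⟩
      exact mem_iUnion₂.2 ⟨(a', c), hcB.2.2, h, hcB.2.1⟩
    · exact Or.inr heq
    · obtain ⟨b', hb', hb''⟩ := exists_rat_btwn hgt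
      left
      refine mem_iUnion.2 ⟨b', Or.inr ⟨⟨hzs, hb'', hzb⟩, fun h => ?_⟩⟩
      have hb'b : b' < b := by exact_mod_cast hb''.trans hzb
      have : (b' : ℝ) ≤ g (p z) := by
        have := le_ciSup (hbdd (p z)) b'
        simp only [hv] at this
        rwa [if_pos ⟨hb'b, h⟩] at this
      exact absurd hb' (not_lt.2 this)
  have := hB s a b _ hWm.compl key
  filter_upwards [measure_eq_zero_iff_ae_notMem.1 this] with x hx hxB
  by_contra hcon
  refine hx ⟨fun hxW => hcon ?_, hxB⟩
  obtain ⟨c, hc, h1, h2⟩ := mem_iUnion₂.1 hxW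
  exact ⟨c.1, c.2, hc, h1, h2⟩

/-- Pointwise branch construction: a family of cells over `x` that can be extended and split
yields a point of the fibre over `x` whose `q`-value avoids a given countable set. -/
theorem exists_fibre_point {X : Type*} [TopologicalSpace X] [T2Space X]
    {p : (ℕ → ℕ) → X} {q : (ℕ → ℕ) → ℝ} (hp : Continuous p) (hq : Continuous q) {x : X}
    {T : List ℕ → ℚ → ℚ → Prop} {a₀ b₀ : ℚ} (h0 : T [] a₀ b₀)
    (hext : ∀ s a b, T s a b → ∃ k, T (k :: s) a b)
    (hsplit : ∀ s a b, T s a b → ∃ a' b' : ℚ, a' < b' ∧ T s a a' ∧ T s b' b)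
    (hcl : ∀ s a b, T s a b → x ∈ closure (p '' cell q s a b)) (y : ℕ → ℝ) :
    ∃ z, p z = x ∧ ∀ n, q z ≠ y n := by
  have step : ∀ (n : ℕ) (t : {t : List ℕ × ℚ × ℚ // T t.1 t.2.1 t.2.2}),
      ∃ t' : {t : List ℕ × ℚ × ℚ // T t.1 t.2.1 t.2.2}, ∃ k,
        t'.1.1 = k :: t.1.1 ∧ y n ∉ Icc (t'.1.2.1 : ℝ) t'.1.2.2 ∧
        cell q t'.1.1 t'.1.2.1 t'.1.2.2 ⊆ cell q t.1.1 t.1.2.1 t.1.2.2 := by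
    rintro n ⟨⟨s, a, b⟩, ht⟩
    obtain ⟨a', b', hab, h1, h2⟩ := hsplit s a b ht
    have hne : ∀ {c d : ℚ}, T s c d → c < d := fun {c d} h => by
      obtain ⟨_, z, hz, _⟩ := closure_nonempty_iff.1 ⟨x, hcl s c d h⟩
      exact_mod_cast hz.2.1.trans hz.2.2
    have hb'b := hne h2
    have haa' := hne h1
    -- Since a' < b', the number `y n` misses one of the closed intervals [b', b], [a, a'].
    by_cases hy : y n < b'
    · obtain ⟨k, hk⟩ := hext s b' b h2
      refine ⟨⟨(k :: s, b', b), hk⟩, k, rfl, fun h => absurd h.1 (not_le.2 hy), ?_⟩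
      rintro z ⟨hz, hz1, hz2⟩
      refine ⟨?_, lt_trans ?_ hz1, hz2⟩
      · simp only [List.length_cons, res_succ, List.cons.injEq] at hz
        exact hz.2
      · exact_mod_cast haa'.trans hab
    · obtain ⟨k, hk⟩ := hext s a a' h1
      have hab' : (a' : ℝ) < b' := by exact_mod_cast hab
      refine ⟨⟨(k :: s, a, a'), hk⟩, k, rfl,
        fun h => absurd h.2 (not_le.2 (hab'.trans_le (not_lt.1 hy))), ?_⟩
      rintro z ⟨hz, hz1, hz2⟩
      refine ⟨?_, hz1, lt_trans hz2 ?_⟩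
      · simp only [List.length_cons, res_succ, List.cons.injEq] at hz
        exact hz.2
      · exact_mod_cast hab.trans hb'b
  choose nxt key hnxt hy hsub using step
  let t : ℕ → {t : List ℕ × ℚ × ℚ // T t.1 t.2.1 t.2.2} :=
    fun n => Nat.rec ⟨([], a₀, b₀), h0⟩ (fun n t => nxt n t) n
  have ht : ∀ n, t (n + 1) = nxt n (t n) := fun _ => rfl
  let z : ℕ → ℕ := fun n => key n (t n)
  have hz : ∀ n, res z n = (t n).1.1 := by
    intro n
    induction n with
    | zero => rfl
    | succ n ih => rw [res_succ, ht, hnxt, ih]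
  let A : ℕ → Set (ℕ → ℕ) := fun n => cell q (t n).1.1 (t n).1.2.1 (t n).1.2.2
  have hA : Antitone A := antitone_nat_of_succ_le fun n => hsub n (t n)
  have hAz : ∀ n, A n ⊆ cylinder z n := by
    intro n w hw
    rw [cylinder_eq_res]
    have := hw.1
    rw [← hz n, res_length] at this
    exact this
  have hAcl : ∀ n, x ∈ closure (p '' A n) := fun n => hcl _ _ _ (t n).2
  have hnhds : ∀ U ∈ 𝓝 z, ∃ n, cylinder z n ⊆ U := by
    intro U hU
    obtain ⟨_, ⟨w, n, rfl⟩, hzw, hwU⟩ :=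
      (isTopologicalBasis_cylinders (fun _ => ℕ)).mem_nhds_iff.1 hU
    exact ⟨n, by rwa [mem_cylinder_iff_eq.1 hzw]⟩
  refine ⟨z, ?_, fun n hn => ?_⟩
  · by_contra hne
    obtain ⟨U, V, hU, hV, hzU, hxV, hUV⟩ := t2_separation hne
    obtain ⟨n, hn⟩ := hnhds _ (hp.continuousAt.preimage_mem_nhds (hU.mem_nhds hzU))
    obtain ⟨_, hwV, w, hw, rfl⟩ := mem_closure_iff.1 (hAcl n) V hV hxV
    exact disjoint_left.1 hUV (hn (hAz n hw)) hwV
  · have hcl' : q z ∈ closure (q '' A (n + 1)) := by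
      rw [mem_closure_iff_nhds]
      intro U hU
      obtain ⟨m, hm⟩ := hnhds _ (hq.continuousAt.preimage_mem_nhds hU)
      obtain ⟨_, w, hw, _⟩ := closure_nonempty_iff.1 ⟨x, hAcl (max m (n + 1))⟩
      exact ⟨q w, hm (hAz m (hA (le_max_left _ _) hw)), w, hA (le_max_right _ _) hw, rfl⟩
    have hsubI : q '' A (n + 1) ⊆ Icc ((t (n + 1)).1.2.1 : ℝ) (t (n + 1)).1.2.2 := by
      rintro _ ⟨w, hw, rfl⟩
      exact ⟨hw.2.1.le, hw.2.2.le⟩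
    have := closure_minimal hsubI isClosed_Icc hcl'
    rw [hn] at this
    exact hy n (t n) this

/-- A continuous image of Baire space in `X × ℝ` with countable sections is almost everywhere
covered by countably many graphs. -/
theorem fibresCovered_univ [TopologicalSpace X] [T2Space X] [BorelSpace X] [IsFiniteMeasure ν]
    {p : (ℕ → ℕ) → X} {q : (ℕ → ℕ) → ℝ} (hp : Continuous p) (hq : Continuous q)
    (hc : ∀ x, (q '' (p ⁻¹' {x})).Countable) : FibresCovered ν p q univ := by
  by_contra hcon
  choose B hBm hBc hB using
    fun s a b => exists_uncovered_set (ν := ν) (p := p) (q := q) (cell q s a b)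
  have hun : (univ : Set (ℕ → ℕ)) = ⋃ c : ℚ × ℚ, cell q [] c.1 c.2 := by
    refine (eq_univ_of_forall fun z => ?_).symm
    obtain ⟨a, ha⟩ := exists_rat_lt (q z)
    obtain ⟨b, hb⟩ := exists_rat_gt (q z)
    exact mem_iUnion.2 ⟨(a, b), rfl, ha, hb⟩
  obtain ⟨⟨a₀, b₀⟩, h0⟩ : ∃ c : ℚ × ℚ, ¬ FibresCovered ν p q (cell q [] c.1 c.2) := by
    by_contra! h
    exact hcon (hun ▸ FibresCovered.iUnion h)
  have hpos : ν (B [] a₀ b₀) ≠ 0 := fun h => h0 <| by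
    rw [← inter_univ (cell q [] a₀ b₀), ← preimage_univ (f := p), ← compl_union_self (B [] a₀ b₀),
      preimage_union, inter_union_distrib_left]
    exact (hBc _ _ _).union (FibresCovered.of_measure_zero h)
  have h1 : ∀ᵐ x ∂ν, ∀ s a b, x ∈ B s a b → ∃ k, x ∈ B (k :: s) a b := by
    rw [ae_all_iff]; intro s; rw [ae_all_iff]; intro a; rw [ae_all_iff]; intro b
    have hm : MeasurableSet (⋃ k, B (k :: s) a b)ᶜ :=
      (MeasurableSet.iUnion fun k => hBm _ _ _).compl
    have hcov : FibresCovered ν p q (cell q s a b ∩ p ⁻¹' (⋃ k, B (k :: s) a b)ᶜ) := by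
      refine (FibresCovered.iUnion fun k => hBc (k :: s) a b).mono ?_
      rintro z ⟨hz, hz'⟩
      rw [cell_eq_iUnion] at hz
      obtain ⟨k, hk⟩ := mem_iUnion.1 hz
      exact mem_iUnion.2 ⟨k, hk, fun h => hz' (mem_iUnion.2 ⟨k, h⟩)⟩
    filter_upwards [measure_eq_zero_iff_ae_notMem.1 (hB s a b _ hm hcov)] with x hx hxB
    by_contra! h
    exact hx ⟨by simpa using h, hxB⟩
  have h2 : ∀ᵐ x ∂ν, ∀ s a b, x ∈ B s a b →
      ∃ a' b' : ℚ, a' < b' ∧ x ∈ B s a a' ∧ x ∈ B s b' b := by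
    rw [ae_all_iff]; intro s; rw [ae_all_iff]; intro a; rw [ae_all_iff]; intro b
    exact ae_exists_split hBm hBc hB s a b
  have h3 : ∀ᵐ x ∂ν, ∀ s a b, x ∈ B s a b → x ∈ closure (p '' cell q s a b) := by
    rw [ae_all_iff]; intro s; rw [ae_all_iff]; intro a; rw [ae_all_iff]; intro b
    have hcov : FibresCovered ν p q (cell q s a b ∩ p ⁻¹' (closure (p '' cell q s a b))ᶜ) := by
      refine FibresCovered.empty.mono ?_
      rintro z ⟨hz, hz'⟩
      exact hz' (subset_closure ⟨z, hz, rfl⟩)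
    filter_upwards [measure_eq_zero_iff_ae_notMem.1
      (hB s a b _ isClosed_closure.measurableSet.compl hcov)] with x hx hxB
    by_contra h
    exact hx ⟨h, hxB⟩
  obtain ⟨x, ⟨hx1, hx2, hx3⟩, hxB⟩ : ∃ x, _ ∧ x ∈ B [] a₀ b₀ :=
    ((h1.and (h2.and h3)).and_frequently (frequently_ae_mem_iff.2 hpos)).exists
  -- Nonemptiness is needed to list the countable fibre as a sequence; the second application then
  -- produces a value outside the list.
  have hne : (q '' (p ⁻¹' {x})).Nonempty := by
    obtain ⟨z, hz, -⟩ := exists_fibre_point hp hq (T := fun s a b => x ∈ B s a b) hxB hx1 hx2 hx3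
      (fun _ => 0)
    exact ⟨q z, z, hz, rfl⟩
  obtain ⟨y, hy⟩ := (hc x).exists_eq_range hne
  obtain ⟨z, hz, hzy⟩ :=
    exists_fibre_point hp hq (T := fun s a b => x ∈ B s a b) hxB hx1 hx2 hx3 y
  have : q z ∈ q '' (p ⁻¹' {x}) := ⟨z, hz, rfl⟩
  rw [hy] at this
  obtain ⟨n, hn⟩ := this
  exact hzy n hn.symm

/-- The classes of a countable Borel equivalence relation are almost everywhere enumerated by
countably many Borel functions. -/
theorem IsCountableBorel.exists_ae_enumeration [TopologicalSpace X] [PolishSpace X] [BorelSpace X]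
    {E : Setoid X} (hE : IsCountableBorel E) (ν : Measure X) [IsFiniteMeasure ν] :
    ∃ h : ℕ → X → X, (∀ i, Measurable (h i)) ∧ (∀ i x, E.r x (h i x)) ∧
      ∀ᵐ x ∂ν, ∀ y, E.r x y → ∃ i, h i x = y := by
  classical
  rcases isEmpty_or_nonempty X with hX | hX
  · exact ⟨fun _ => id, fun _ => measurable_id, fun _ x => isEmptyElim x,
      Eventually.of_forall fun x => isEmptyElim x⟩
  -- Coding the second coordinate by reals turns the relation into a Borel, hence analytic, subset
  -- of X × ℝ with countable sections.
  obtain ⟨e, he⟩ := exists_measurableEmbedding_real X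
  obtain ⟨inv, hinv, hinve⟩ := he.exists_measurable_extend measurable_id (fun _ => hX)
  have hinv' : ∀ x, inv (e x) = x := fun x => congrFun hinve x
  set R : Set (X × ℝ) := {c | E.r c.1 (inv c.2) ∧ e (inv c.2) = c.2} with hR
  have hRm : MeasurableSet R := by
    refine MeasurableSet.inter ?_ ?_
    · exact (measurable_fst.prodMk (hinv.comp measurable_snd)) hE.borel
    · exact measurableSet_eq_fun (he.measurable.comp (hinv.comp measurable_snd)) measurable_snd
  obtain ⟨g, hg, hgx⟩ : ∃ g : ℕ → X → ℝ, (∀ i, Measurable (g i)) ∧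
      ∀ᵐ x ∂ν, ∀ y, E.r x y → ∃ i, e y = g i x := by
    have hRa := hRm.analyticSet
    rw [AnalyticSet] at hRa
    rcases hRa with h | ⟨φ, hφ, hφR⟩
    · obtain ⟨x⟩ := hX
      have : (x, e x) ∈ R := ⟨by rw [hinv'], by simp only [hinv']⟩
      simp [h] at this
    · obtain ⟨g, hg, hgx⟩ := fibresCovered_univ (ν := ν) (p := fun z => (φ z).1)
        (q := fun z => (φ z).2) (by fun_prop) (by fun_prop) (fun x => by
          refine ((hE.countable x).image e).mono ?_
          rintro _ ⟨z, rfl, rfl⟩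
          have : φ z ∈ R := hφR ▸ mem_range_self z
          exact ⟨_, this.1, this.2⟩)
      refine ⟨g, hg, hgx.mono fun x hx y hxy => ?_⟩
      have : (x, e y) ∈ R := ⟨by rwa [hinv'], by rw [hinv']⟩
      rw [← hφR] at this
      obtain ⟨z, hz⟩ := this
      simpa only [hz] using hx z (mem_univ _) (by simp only [hz])
  refine ⟨fun i x => if E.r x (inv (g i x)) then inv (g i x) else x, fun i => ?_, fun i x => ?_, ?_⟩
  · exact Measurable.ite ((measurable_id.prodMk (hinv.comp (hg i))) hE.borel)
      (hinv.comp (hg i)) measurable_id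
  · dsimp only
    split_ifs with h
    · exact h
    · exact E.refl x
  · filter_upwards [hgx] with x hx y hxy
    obtain ⟨i, hi⟩ := hx y hxy
    refine ⟨i, ?_⟩
    rw [← hi, hinv', if_pos hxy]

end LusinNovikov

/-! ### Quasi-invariant measures and invariant conull sets -/

section QuasiInvariant

open Set Filter Topology

variable {X : Type*} [MeasurableSpace X]

/-- Every finite measure is absolutely continuous with respect to a finite measure for which the
saturations of null sets are null. -/
theorem IsCountableBorel.exists_quasiInvariant [TopologicalSpace X] [PolishSpace X] [BorelSpace X]
    {E : Setoid X} (hE : IsCountableBorel E) (μ : Measure X) [IsFiniteMeasure μ] :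
    ∃ ν : Measure X, IsFiniteMeasure ν ∧ μ ≪ ν ∧
      ∀ N, ν N = 0 → ν {x | ∃ y ∈ N, E.r x y} = 0 := by
  obtain ⟨g, hg, hgE, hgx⟩ := hE.exists_ae_enumeration μ
  set ν₀ : Measure X := Measure.sum fun i => μ.map (g i) with hν₀
  have hnull : ∀ N, ν₀ N = 0 → ∀ᵐ x ∂μ, ∀ i, g i x ∉ N := fun N hN => by
    rw [ae_all_iff]
    intro i
    have h1 : μ.map (g i) N = 0 := Measure.absolutelyContinuous_of_le (Measure.le_sum _ i) hN
    exact measure_eq_zero_iff_ae_notMem.1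
      (Measure.preimage_null_of_map_null (hg i).aemeasurable h1)
  have hsat : ∀ N, MeasurableSet N → ν₀ N = 0 → ∀ᵐ x ∂ν₀, ∀ y ∈ N, ¬ E.r x y := by
    intro N hNm hN
    -- The functions `g` enumerate classes only μ-almost everywhere, so a second enumeration is
    -- taken for ν₀. Each h_i(g_j(x)) is again some g_k(x), which avoids `N` for μ-almost every x.
    obtain ⟨h, hh, hhE, hhx⟩ := hE.exists_ae_enumeration ν₀.toFinite
    have hhx' := absolutelyContinuous_toFinite ν₀ |>.ae_le hhx
    have hA : ∀ᵐ x ∂ν₀, ∀ i, h i x ∉ N := by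
      have hm : MeasurableSet {x | ∀ i, h i x ∉ N} := by
        simp only [ofPred_forall]
        exact MeasurableSet.iInter fun i => (hh i) hNm.compl
      rw [hν₀, Measure.ae_sum_iff' hm]
      intro j
      rw [ae_map_iff (hg j).aemeasurable hm]
      filter_upwards [hgx, hnull N hN] with x hx1 hx2 i
      obtain ⟨k, hk⟩ := hx1 (h i (g j x)) (E.trans (hgE j x) (hhE i _))
      rw [← hk]
      exact hx2 k
    filter_upwards [hhx', hA] with x hx1 hx2 y hy hxy
    obtain ⟨i, rfl⟩ := hx1 y hxy
    exact hx2 i hy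
  refine ⟨ν₀.toFinite, inferInstance, ?_, fun N hN => ?_⟩
  · refine Measure.AbsolutelyContinuous.trans ?_ (absolutelyContinuous_toFinite ν₀)
    intro N hN
    refine measure_eq_zero_iff_ae_notMem.2 ?_
    filter_upwards [hgx, hnull N hN] with x hx1 hx2
    obtain ⟨i, hi⟩ := hx1 x (E.refl x)
    rw [← hi]
    exact hx2 i
  · refine toFinite_absolutelyContinuous ν₀ (measure_eq_zero_iff_ae_notMem.2 ?_)
    have := hsat (toMeasurable ν₀ N) (measurableSet_toMeasurable _ _)
      (by rw [measure_toMeasurable]; exact absolutelyContinuous_toFinite ν₀ hN)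
    filter_upwards [this] with x hx
    rintro ⟨y, hy, hxy⟩
    exact hx y (subset_toMeasurable _ _ hy) hxy

/-- If saturations of null sets are null, then an almost everywhere property holds everywhere on
some invariant conull measurable set. -/
theorem exists_invariant_conull {E : Setoid X} {ν : Measure X}
    (hν : ∀ N, ν N = 0 → ν {x | ∃ y ∈ N, E.r x y} = 0) {P : X → Prop} (hP : ∀ᵐ x ∂ν, P x) :
    ∃ C, MeasurableSet C ∧ IsInvariant E C ∧ ν Cᶜ = 0 ∧ ∀ x ∈ C, P x := by
  -- Saturations and measurable hulls alternate; in the union each step absorbs the saturation of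
  -- the previous one.
  let N : ℕ → Set X := fun n => Nat.rec (toMeasurable ν {x | ¬ P x})
    (fun _ M => toMeasurable ν {x | ∃ y ∈ M, E.r x y}) n
  have hN0 : ∀ n, ν (N n) = 0 := by
    intro n
    induction n with
    | zero => exact (measure_toMeasurable _).trans (ae_iff.1 hP)
    | succ n ih => exact (measure_toMeasurable _).trans (hν _ ih)
  have hNm : ∀ n, MeasurableSet (N n) := by
    intro n
    cases n <;> exact measurableSet_toMeasurable _ _
  refine ⟨(⋃ n, N n)ᶜ, (MeasurableSet.iUnion hNm).compl, ?_, ?_, ?_⟩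
  · intro x hx y hxy hy
    obtain ⟨n, hn⟩ := mem_iUnion.1 hy
    exact hx (mem_iUnion.2 ⟨n + 1, subset_toMeasurable _ _ ⟨y, hn, hxy⟩⟩)
  · rw [compl_compl]
    exact measure_iUnion_null hN0
  · intro x hx
    by_contra h
    exact hx (mem_iUnion.2 ⟨0, subset_toMeasurable _ _ h⟩)

end QuasiInvariant

/-! ### Separability and Cantor schemes of intervals -/

section PerfectScheme

open Set Filter Topology

/-- The space of measurable functions to `ℕ`, with the distance `ν {f ≠ g}`, is separable. -/
theorem exists_code {X : Type*} [MeasurableSpace X] (ν : Measure X) [IsFiniteMeasure ν]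
    [IsSeparable ν] {ε : ENNReal} (hε : ε ≠ 0) :
    ∃ c : (X → ℕ) → ℕ, ∀ f g : X → ℕ, Measurable f → Measurable g → c f = c g →
      ν {x | f x ≠ g x} ≤ ε := by
  classical
  obtain ⟨𝒜, h𝒜, hd⟩ := exists_countable_measureDense ν
  have hε3 : ε / 3 ≠ 0 := (ENNReal.div_pos hε (by simp)).ne'
  obtain ⟨δ, hδ, hδε⟩ := ENNReal.exists_pos_sum_of_countable hε3 ℕ
  have hK : ∀ f : {f : X → ℕ // Measurable f}, ∃ K, ν {x | K ≤ f.1 x} ≤ ε / 3 := by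
    rintro ⟨f, hf⟩
    have hanti : Antitone fun K : ℕ => {x | K ≤ f x} := fun K L h x (hx : L ≤ f x) => h.trans hx
    have hlim := tendsto_measure_iInter_atTop (μ := ν) (s := fun K : ℕ => {x | K ≤ f x})
      (fun K => (measurableSet_le measurable_const hf).nullMeasurableSet) hanti
      ⟨0, measure_ne_top _ _⟩
    have hemp : ⋂ K : ℕ, {x | K ≤ f x} = ∅ := by
      refine eq_empty_of_forall_notMem fun x hx => ?_
      have : f x + 1 ≤ f x := mem_iInter.1 hx (f x + 1)
      omega
    rw [hemp, measure_empty] at hlim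
    obtain ⟨K, hK⟩ := (hlim.eventually (gt_mem_nhds (pos_iff_ne_zero.2 hε3))).exists
    exact ⟨K, hK.le⟩
  choose K hK using hK
  have happ : ∀ (f : {f : X → ℕ // Measurable f}) (i : ℕ),
      ∃ A : 𝒜, ν (symmDiff {x | f.1 x = i} A) < δ i := by
    rintro ⟨f, hf⟩ i
    obtain ⟨A, hA, hlt⟩ := hd.approx _ (hf (measurableSet_singleton i)) (measure_ne_top _ _) (δ i)
      (by exact_mod_cast hδ i)
    rw [ENNReal.ofReal_coe_nnreal] at hlt
    exact ⟨⟨A, hA⟩, hlt⟩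
  choose A hA using happ
  have : Countable 𝒜 := h𝒜.to_subtype
  obtain ⟨enc, henc⟩ := exists_injective_nat (Σ K : ℕ, Fin K → 𝒜)
  -- The code records a truncation level and approximations to the level sets below it. The thirds
  -- of ε pay for the tail of `f` and for the approximation errors of `f` and `g`.
  refine ⟨fun f => if hf : Measurable f then enc ⟨K ⟨f, hf⟩, fun i => A ⟨f, hf⟩ i⟩ else 0, ?_⟩
  intro f g hf hg hfg
  simp only [dif_pos hf, dif_pos hg] at hfg
  have hpair := henc hfg
  set f' : {f : X → ℕ // Measurable f} := ⟨f, hf⟩ with hf'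
  set g' : {f : X → ℕ // Measurable f} := ⟨g, hg⟩ with hg'
  have hAA : ∀ i < K f', (A f' i : Set X) = A g' i := by
    have h1 : K f' = K g' := congrArg Sigma.fst hpair
    have h2 : ∀ {m n : ℕ} {a : ℕ → 𝒜} {b : ℕ → 𝒜},
        (⟨m, fun i : Fin m => a i⟩ : Σ K : ℕ, Fin K → 𝒜) = ⟨n, fun i : Fin n => b i⟩ →
        ∀ i < m, a i = b i := by
      intro m n a b h i hi
      obtain rfl : m = n := congrArg Sigma.fst h
      have := eq_of_heq (Sigma.mk.inj h).2
      exact congrFun this ⟨i, hi⟩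
    exact fun i hi => congrArg Subtype.val (h2 hpair i hi)
  have hsub : {x | f x ≠ g x} ⊆ {x | K f' ≤ f x} ∪
      ⋃ i, if i < K f' then (symmDiff {x | f x = i} (A f' i) ∪ symmDiff {x | g x = i} (A g' i))
        else ∅ := by
    intro x hx
    rcases le_or_gt (K f') (f x) with h | h
    · exact Or.inl h
    · refine Or.inr (mem_iUnion.2 ⟨f x, ?_⟩)
      rw [if_pos h]
      by_cases hxA : x ∈ (A f' (f x) : Set X)
      · refine Or.inr (Or.inr ⟨by rw [← hAA _ h]; exact hxA, fun h' => hx ?_⟩)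
        exact (Eq.symm h' : f x = g x)
      · exact Or.inl (Or.inl ⟨rfl, hxA⟩)
  calc ν {x | f x ≠ g x}
      ≤ ν {x | K f' ≤ f x} + ∑' i, ν (if i < K f' then (symmDiff {x | f x = i} (A f' i) ∪
          symmDiff {x | g x = i} (A g' i)) else ∅) :=
        (measure_mono hsub).trans ((measure_union_le _ _).trans (by gcongr; exact measure_iUnion_le _))
    _ ≤ ε / 3 + ∑' i, ((δ i : ENNReal) + δ i) := by
        refine add_le_add (hK f') (ENNReal.tsum_le_tsum fun i => ?_)
        split_ifs
        · exact (measure_union_le _ _).trans (add_le_add (hA f' i).le (hA g' i).le)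
        · simp
    _ ≤ ε / 3 + (ε / 3 + ε / 3) := by
        rw [ENNReal.tsum_add]
        gcongr
    _ = ε := by rw [← add_assoc, ENNReal.add_thirds]

/-- An uncountable set of reals has two uncountable pieces, separated by its points. -/
theorem exists_split_of_not_countable {T : Set ℝ} (hT : ¬ T.Countable) :
    ∃ l u : Bool → ℝ, (∀ b, l b ∈ T ∧ u b ∈ T ∧ l b < u b ∧ ¬ (T ∩ Ioo (l b) (u b)).Countable) ∧
      u false < l true := by
  set N : Set ℝ := ⋃ (c : ℚ × ℚ) (_ : (T ∩ Ioo (c.1 : ℝ) c.2).Countable), T ∩ Ioo (c.1 : ℝ) c.2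
  have hN : N.Countable := countable_iUnion fun c => countable_iUnion fun h => h
  have hTN : (T \ N).Infinite := fun h =>
    hT ((h.countable.union hN).mono fun x hx => by
      by_cases hxN : x ∈ N
      · exact Or.inr hxN
      · exact Or.inl ⟨hx, hxN⟩)
  have hcond : ∀ l x u : ℝ, x ∈ T \ N → l < x → x < u → ¬ (T ∩ Ioo l u).Countable := by
    intro l x u hx hl hu h
    obtain ⟨a, ha, ha'⟩ := exists_rat_btwn hl
    obtain ⟨b, hb, hb'⟩ := exists_rat_btwn hu
    have hab : (T ∩ Ioo (a : ℝ) b).Countable :=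
      h.mono (inter_subset_inter_right _ (Ioo_subset_Ioo ha.le hb'.le))
    have hxm : x ∈ T ∩ Ioo (a : ℝ) b := ⟨hx.1, ha', hb⟩
    exact hx.2 (mem_iUnion₂.2 ⟨(a, b), hab, hxm⟩)
  -- Two triples of condensation points: the outer two are endpoints, and the middle one makes the
  -- piece between them uncountable.
  obtain ⟨s, hs, hcard⟩ := hTN.exists_subset_card_eq 6
  let e := s.orderEmbOfFin hcard
  have he : ∀ i, e i ∈ T \ N := fun i => hs (s.orderEmbOfFin_mem hcard i)
  have hlt : ∀ i j : Fin 6, i < j → e i < e j := fun i j h => e.strictMono h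
  refine ⟨fun b => if b then e 3 else e 0, fun b => if b then e 5 else e 2, fun b => ?_, ?_⟩
  · cases b
    · exact ⟨(he 0).1, (he 2).1, hlt 0 2 (by decide),
        hcond _ (e 1) _ (he 1) (hlt 0 1 (by decide)) (hlt 1 2 (by decide))⟩
    · exact ⟨(he 3).1, (he 5).1, hlt 3 5 (by decide),
        hcond _ (e 4) _ (he 4) (hlt 3 4 (by decide)) (hlt 4 5 (by decide))⟩
  · exact hlt 2 3 (by decide)

/-- The same with the pieces contained in one class of a countable partition. -/
theorem exists_homogeneous_split (K : ℝ → ℕ) {T : Set ℝ} (hT : ¬ T.Countable) :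
    ∃ (c : ℕ) (l u : Bool → ℝ) (T' : Bool → Set ℝ), (∀ b, l b ∈ T ∩ K ⁻¹' {c} ∧
      u b ∈ T ∩ K ⁻¹' {c} ∧ l b < u b ∧ ¬ (T' b).Countable ∧ T' b ⊆ T ∩ K ⁻¹' {c} ∧
      T' b ⊆ Ioo (l b) (u b)) ∧ u false < l true := by
  obtain ⟨c, hc⟩ : ∃ c, ¬ (T ∩ K ⁻¹' {c}).Countable := by
    by_contra! h
    refine hT ((countable_iUnion h).mono fun x hx => ?_)
    exact mem_iUnion.2 ⟨K x, hx, rfl⟩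
  obtain ⟨l, u, h, hlu⟩ := exists_split_of_not_countable hc
  exact ⟨c, l, u, fun b => (T ∩ K ⁻¹' {c}) ∩ Ioo (l b) (u b), fun b => ⟨(h b).1, (h b).2.1,
    (h b).2.2.1, (h b).2.2.2, inter_subset_left, inter_subset_right⟩, hlu⟩

/-- A Cantor scheme of intervals whose endpoints (and those of the children) have the same codes. -/
theorem exists_interval_scheme (K : ℕ → ℝ → ℕ) :
    ∃ l u : List Bool → ℝ, (∀ v, l v < u v) ∧ (∀ b v, l v < l (b :: v)) ∧
      (∀ b v, u (b :: v) < u v) ∧ (∀ v, u (false :: v) < l (true :: v)) ∧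
      ∀ b v, K v.length (l (b :: v)) = K v.length (u (b :: v)) ∧
        ∀ b', K v.length (l (b' :: b :: v)) = K v.length (l (b :: v)) := by
  let Node := {t : Set ℝ × ℝ × ℝ // ¬ t.1.Countable ∧ t.1 ⊆ Ioo t.2.1 t.2.2 ∧ t.2.1 < t.2.2}
  have step : ∀ (n : ℕ) (t : Node), ∃ (c : ℕ) (t' : Bool → Node),
      (∀ b, (t' b).1.1 ⊆ t.1.1 ∩ K n ⁻¹' {c} ∧ (t' b).1.2.1 ∈ t.1.1 ∩ K n ⁻¹' {c} ∧
        (t' b).1.2.2 ∈ t.1.1 ∩ K n ⁻¹' {c}) ∧ (t' false).1.2.2 < (t' true).1.2.1 := by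
    rintro n ⟨⟨T, l, u⟩, hT, hsub, hlu⟩
    obtain ⟨c, l', u', T', h, hlt⟩ := exists_homogeneous_split (K n) hT
    exact ⟨c, fun b => ⟨(T' b, l' b, u' b), (h b).2.2.2.1, (h b).2.2.2.2.2, (h b).2.2.1⟩,
      fun b => ⟨(h b).2.2.2.2.1, (h b).1, (h b).2.1⟩, hlt⟩
  choose c t' hc hlt using step
  have hroot : ¬ (Ioo (0 : ℝ) 1).Countable := fun h =>
    absurd (measure_mono_null subset_rfl (h.measure_zero volume)) (by simp)
  let root : Node := ⟨(Ioo 0 1, 0, 1), hroot, subset_rfl, one_pos⟩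
  let N : List Bool → Node := fun v => List.rec root (fun b v t => t' v.length t b) v
  have hN : ∀ b v, N (b :: v) = t' v.length (N v) b := fun _ _ => rfl
  refine ⟨fun v => (N v).1.2.1, fun v => (N v).1.2.2, fun v => (N v).2.2.2, fun b v => ?_,
    fun b v => ?_, fun v => ?_, fun b v => ⟨?_, fun b' => ?_⟩⟩
  · exact ((N v).2.2.1 (hc v.length (N v) b).2.1.1).1
  · exact ((N v).2.2.1 (hc v.length (N v) b).2.2.1).2
  · exact hlt _ _
  · exact (hc v.length (N v) b).2.1.2.trans (hc v.length (N v) b).2.2.2.symm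
  -- The endpoints of a grandchild lie in the child's uncountable set, which is already homogeneous
  -- for the code of level |v|.
  · exact ((hc v.length (N v) b).1 (hc _ (N (b :: v)) b').2.1.1).2.trans
      (hc v.length (N v) b).2.1.2.symm

/-- For a family, indexed by the reals, of sequences of measurable functions to `ℕ`, there is a
Cantor scheme of intervals along which almost everywhere all the functions are eventually
constant. -/
theorem exists_interval_scheme_ae {X : Type*} [MeasurableSpace X] (ν : Measure X)
    [IsFiniteMeasure ν] [IsSeparable ν] (f : ℝ → ℕ → X → ℕ)
    (hf : ∀ r m, Measurable (f r m)) :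
    ∃ l u : List Bool → ℝ, (∀ v, l v < u v) ∧ (∀ b v, l v < l (b :: v)) ∧
      (∀ b v, u (b :: v) < u v) ∧ (∀ v, u (false :: v) < l (true :: v)) ∧
      ∀ᵐ x ∂ν, ∀ m, ∃ n, ∀ v : List Bool, n ≤ v.length → f (l v) m x = f (u v) m x ∧
        ∀ b, f (l (b :: v)) m x = f (l v) m x := by
  let F : ℕ → ℝ → X → ℕ := fun n r x => Encodable.encode fun i : Fin (n + 1) => f r i x
  have hF : ∀ n r, Measurable (F n r) := fun n r =>
    (measurable_of_countable _).comp (measurable_pi_lambda _ fun i => hf r i)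
  have hFf : ∀ {n r s x}, F n r x = F n s x → ∀ m ≤ n, f r m x = f s m x :=
    fun h m hm => congrFun (Encodable.encode_injective h) ⟨m, Nat.lt_succ_of_le hm⟩
  -- Each word of length n + 1 needs three comparisons: with its upper endpoint (`none`) and with
  -- the lower endpoints of its two children (`some b`).
  let ε : ℕ → ENNReal := fun n => 2⁻¹ ^ n / Fintype.card (List.Vector Bool (n + 1) × Option Bool)
  have hε : ∀ n, ε n ≠ 0 := fun n =>
    (ENNReal.div_pos (pow_ne_zero _ (by simp)) (ENNReal.natCast_ne_top _)).ne'
  choose c hc using fun n => exists_code ν (hε n)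
  obtain ⟨l, u, h1, h2, h3, h4, h5⟩ := exists_interval_scheme fun n r => c n (F n r)
  refine ⟨l, u, h1, h2, h3, h4, ?_⟩
  let r : ∀ n, List.Vector Bool (n + 1) × Option Bool → ℝ :=
    fun n w => match w.2 with
      | none => u w.1.1
      | some b => l (b :: w.1.1)
  let bad : ℕ → Set X := fun n => ⋃ w : List.Vector Bool (n + 1) × Option Bool,
    {x | F n (l w.1.1) x ≠ F n (r n w) x}
  have hbad : ∀ n, ν (bad n) ≤ 2⁻¹ ^ n := by
    intro n
    have hle : ∀ w : List.Vector Bool (n + 1) × Option Bool,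
        ν {x | F n (l w.1.1) x ≠ F n (r n w) x} ≤ ε n := by
      rintro ⟨⟨v, hv⟩, o⟩
      obtain ⟨b, v, rfl⟩ : ∃ b v', v = b :: v' := by
        cases v with
        | nil => simp at hv
        | cons b v => exact ⟨b, v, rfl⟩
      obtain rfl : v.length = n := by simpa using hv
      refine hc _ _ _ (hF _ _) (hF _ _) ?_
      cases o with
      | none => exact (h5 b v).1
      | some b' => exact ((h5 b v).2 b').symm
    calc ν (bad n) ≤ ∑ w : List.Vector Bool (n + 1) × Option Bool,
          ν {x | F n (l w.1.1) x ≠ F n (r n w) x} := measure_iUnion_fintype_le _ _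
      _ ≤ ∑ _w : List.Vector Bool (n + 1) × Option Bool, ε n := Finset.sum_le_sum fun w _ => hle w
      _ = Fintype.card (List.Vector Bool (n + 1) × Option Bool) * ε n := by simp
      _ ≤ 2⁻¹ ^ n := ENNReal.mul_div_le
  have hsum : ∑' n, ν (bad n) ≠ ⊤ := by
    refine ne_top_of_le_ne_top ?_ (ENNReal.tsum_le_tsum hbad)
    rw [ENNReal.tsum_geometric]
    simp
  filter_upwards [ae_eventually_notMem hsum] with x hx m
  obtain ⟨n, hn⟩ := eventually_atTop.1 hx
  -- Words of length k + 1 are controlled by `bad k`, where k must also be at least m for the tuple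
  -- to contain `f r m`.
  refine ⟨max n m + 1, fun v hv => ?_⟩
  obtain ⟨k, hk⟩ : ∃ k, v.length = k + 1 := ⟨v.length - 1, by omega⟩
  have hgood : ∀ w : Option Bool, F k (l v) x = F k (r k (⟨v, hk⟩, w)) x := by
    intro w
    by_contra h
    exact hn k (by omega) (mem_iUnion.2 ⟨(⟨v, hk⟩, w), h⟩)
  exact ⟨hFf (hgood none) m (by omega), fun b => (hFf (hgood (some b)) m (by omega)).symm⟩

end PerfectScheme

/-! ### Limits of actions and branches given by cuts -/

section LimitActions

open Set Filter Topology PiNat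

/-- One plus the first index of a set containing `x`, and zero if there is none. -/
noncomputable def firstIndex {X : Type*} (S : ℕ → Set X) (x : X) : ℕ :=
  open Classical in if h : ∃ i, x ∈ S i then Nat.find h + 1 else 0

theorem mem_of_firstIndex_eq {X : Type*} {S : ℕ → Set X} {x : X} {k : ℕ}
    (h : firstIndex S x = k + 1) : x ∈ S k := by
  classical
  unfold firstIndex at h
  split_ifs at h with hS
  obtain rfl : Nat.find hS = k := by omega
  exact Nat.find_spec hS

theorem exists_firstIndex_eq {X : Type*} {S : ℕ → Set X} {x : X} (h : ∃ i, x ∈ S i) :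
    ∃ k, firstIndex S x = k + 1 := by
  classical
  exact ⟨Nat.find h, dif_pos h⟩

theorem measurable_firstIndex {X : Type*} [MeasurableSpace X] {S : ℕ → Set X}
    (hS : ∀ i, MeasurableSet (S i)) : Measurable (firstIndex S) := by
  classical
  have hex : ∀ x, ∃ n, (n = 0 ∧ ∀ i, x ∉ S i) ∨ ∃ i, n = i + 1 ∧ x ∈ S i := fun x => by
    by_cases h : ∃ i, x ∈ S i
    · obtain ⟨i, hi⟩ := h
      exact ⟨i + 1, Or.inr ⟨i, rfl, hi⟩⟩
    · exact ⟨0, Or.inl ⟨rfl, not_exists.1 h⟩⟩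
  have heq : firstIndex S = fun x => Nat.find (hex x) := by
    funext x
    symm
    rw [Nat.find_eq_iff]
    by_cases h : ∃ i, x ∈ S i
    · have hfi : firstIndex S x = Nat.find h + 1 := dif_pos h
      rw [hfi]
      refine ⟨Or.inr ⟨_, rfl, Nat.find_spec h⟩, ?_⟩
      rintro n hn (⟨-, h'⟩ | ⟨i, rfl, hi⟩)
      · exact h' _ (Nat.find_spec h)
      · exact Nat.find_min h (by omega) hi
    · have hfi : firstIndex S x = 0 := dif_neg h
      rw [hfi]
      exact ⟨Or.inl ⟨rfl, not_exists.1 h⟩, fun n hn => absurd hn (Nat.not_lt_zero _)⟩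
  rw [heq]
  refine measurable_find hex fun k => ?_
  have : {x | (k = 0 ∧ ∀ i, x ∉ S i) ∨ ∃ i, k = i + 1 ∧ x ∈ S i} =
      ({_x | k = 0} ∩ ⋂ i, (S i)ᶜ) ∪ ⋃ i, ({_x | k = i + 1} ∩ S i) := by
    ext x
    simp
  rw [this]
  exact ((MeasurableSet.const _).inter (MeasurableSet.iInter fun i => (hS i).compl)).union
    (MeasurableSet.iUnion fun i => (MeasurableSet.const _).inter (hS i))

variable {Γ X : Type*} [Group Γ]

theorem act_one (a : MulAction Γ X) (x : X) : act a 1 x = x :=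
  letI := a
  one_smul Γ x

theorem act_mul (a : MulAction Γ X) (γ δ : Γ) (x : X) : act a (γ * δ) x = act a γ (act a δ x) :=
  letI := a
  mul_smul γ δ x

theorem orb_iff {a : MulAction Γ X} {x y : X} : (orb a).r x y ↔ ∃ γ, act a γ x = y := by
  let := a
  constructor
  · rintro h
    obtain ⟨γ, hγ⟩ := (orb a).symm h
    exact ⟨γ, hγ⟩
  · rintro ⟨γ, hγ⟩
    exact (orb a).symm ⟨γ, hγ⟩

/-- A sequence of actions that converges pointwise (in the discrete topology) on an invariant
set has a limit there, which can be combined with any action on the complement. -/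
theorem exists_limit_action {E : Setoid X} {C : Set X} (hC : IsInvariant E C)
    {B : ℕ → MulAction Γ X} (hB : ∀ n, orb (B n) ≤ E) {a₀ : MulAction Γ X} (ha₀ : orb a₀ ≤ E)
    (hconv : ∀ x ∈ C, ∀ γ, ∃ y, ∀ᶠ n in atTop, act (B n) γ x = y) :
    ∃ a : MulAction Γ X, (∀ x ∈ C, ∀ γ, ∀ᶠ n in atTop, act (B n) γ x = act a γ x) ∧
      ∀ x ∉ C, ∀ γ, act a γ x = act a₀ γ x := by
  classical
  choose! L hL using hconv
  have huniq : ∀ {x y γ}, x ∈ C → (∀ᶠ n in atTop, act (B n) γ x = y) → L x γ = y := by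
    intro x y γ hx h
    obtain ⟨n, h1, h2⟩ := ((hL x hx γ).and h).exists
    exact h1.symm.trans h2
  have hLC : ∀ {x γ}, x ∈ C → L x γ ∈ C := by
    intro x γ hx
    obtain ⟨n, hn⟩ := (hL x hx γ).exists
    exact hC x hx _ (hB n (orb_iff.2 ⟨γ, hn⟩))
  have hC₀ : ∀ {x γ}, x ∉ C → act a₀ γ x ∉ C := fun {x γ} hx h =>
    hx (hC _ h _ (E.symm (ha₀ (orb_iff.2 ⟨γ, rfl⟩))))
  let a : MulAction Γ X :=
    { smul := fun γ x => if x ∈ C then L x γ else act a₀ γ x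
      one_smul := fun x => by
        change (if x ∈ C then L x 1 else act a₀ 1 x) = x
        split_ifs with hx
        · exact huniq hx (Eventually.of_forall fun n => act_one _ _)
        · exact act_one _ _
      mul_smul := fun γ δ x => by
        change (if x ∈ C then L x (γ * δ) else act a₀ (γ * δ) x) =
          (if (if x ∈ C then L x δ else act a₀ δ x) ∈ C
            then L (if x ∈ C then L x δ else act a₀ δ x) γ
            else act a₀ γ (if x ∈ C then L x δ else act a₀ δ x))
        by_cases hx : x ∈ C
        · simp only [if_pos hx, if_pos (hLC (γ := δ) hx)]
          refine huniq hx ?_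
          filter_upwards [hL x hx δ, hL _ (hLC (γ := δ) hx) γ] with n h1 h2
          rw [act_mul, h1, h2]
        · simp only [if_neg hx, if_neg (hC₀ (γ := δ) hx)]
          exact act_mul _ _ _ _ }
  have ha : ∀ γ x, act a γ x = if x ∈ C then L x γ else act a₀ γ x := fun _ _ => rfl
  refine ⟨a, fun x hx γ => ?_, fun x hx γ => ?_⟩
  · rw [ha, if_pos hx]
    exact hL x hx γ
  · rw [ha, if_neg hx]

/-- The cut of a real number in an enumeration of the rationals. -/
noncomputable def cut (q : ℕ → ℚ) (r : ℝ) (n : ℕ) : Bool :=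
  open Classical in decide ((q n : ℝ) < r)

/-- A rational between the two reals makes the cuts differ, and monotonicity of cuts fixes the
values at the first difference. Thus the order of the reals is the lexicographic order of their
branches. -/
theorem exists_first_difference {q : ℕ → ℚ} (hq : Function.Surjective q) {r s : ℝ} (h : r < s) :
    ∃ n, res (cut q r) n = res (cut q s) n ∧ cut q r n = false ∧ cut q s n = true := by
  classical
  have hex : ∃ n, cut q r n ≠ cut q s n := by
    obtain ⟨c, hc, hc'⟩ := exists_rat_btwn h
    obtain ⟨n, rfl⟩ := hq c
    exact ⟨n, by simp [cut, hc', hc.le]⟩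
  refine ⟨Nat.find hex, res_eq_res.2 fun m hm => not_not.1 (Nat.find_min hex hm), ?_⟩
  have hne := Nat.find_spec hex
  generalize Nat.find hex = n at hne
  simp only [cut, ne_eq, decide_eq_decide, decide_eq_false_iff_not, decide_eq_true_eq] at *
  have : (q n : ℝ) < r → (q n : ℝ) < s := fun h' => h'.trans h
  tauto

theorem measurableSet_res_cut_eq (q : ℕ → ℚ) (n : ℕ) (v : List Bool) :
    MeasurableSet {r : ℝ | res (cut q r) n = v} := by
  induction n generalizing v with
  | zero => simp only [res_zero, MeasurableSet.const]
  | succ n ih =>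
    cases v with
    | nil => simp [res_succ]
    | cons b v =>
      simp only [res_succ, List.cons.injEq]
      refine MeasurableSet.inter (s₁ := {r | cut q r n = b}) ?_ (ih v)
      cases b
      · have : {r | cut q r n = false} = Iic (q n : ℝ) := by ext; simp [cut]
        rw [this]
        exact measurableSet_Iic
      · have : {r | cut q r n = true} = Ioi (q n : ℝ) := by ext; simp [cut]
        rw [this]
        exact measurableSet_Ioi

/-- Limits along the branches of a scheme of nested separated intervals. -/
theorem exists_strictMono_of_scheme {q : ℕ → ℚ} (hq : Function.Surjective q) {l u : List Bool → ℝ}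
    (hlu : ∀ v, l v < u v) (hl : ∀ b v, l v < l (b :: v)) (hu : ∀ b v, u (b :: v) < u v)
    (hsep : ∀ v, u (false :: v) < l (true :: v)) :
    ∃ π : ℝ → ℝ, StrictMono π ∧
      ∀ r n, l (res (cut q r) n) ≤ π r ∧ π r ≤ u (res (cut q r) n) := by
  have hlm : ∀ r, Monotone fun n => l (res (cut q r) n) := fun r =>
    monotone_nat_of_le_succ fun n => by rw [res_succ]; exact (hl _ _).le
  have hum : ∀ r, Antitone fun n => u (res (cut q r) n) := fun r =>
    antitone_nat_of_succ_le fun n => by rw [res_succ]; exact (hu _ _).le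
  have hle : ∀ r m n, l (res (cut q r) m) ≤ u (res (cut q r) n) := fun r m n =>
    (hlm r (le_max_left m n)).trans ((hlu _).le.trans (hum r (le_max_right m n)))
  have hπ : ∀ r n, l (res (cut q r) n) ≤ (⨆ n, l (res (cut q r) n)) ∧
      (⨆ n, l (res (cut q r) n)) ≤ u (res (cut q r) n) := fun r n =>
    ⟨le_ciSup (f := fun n => l (res (cut q r) n)) ⟨u (res (cut q r) 0), by
      rintro _ ⟨m, rfl⟩; exact hle r m 0⟩ n, ciSup_le fun m => hle r m n⟩
  refine ⟨fun r => ⨆ n, l (res (cut q r) n), fun r s hrs => ?_, hπ⟩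
  obtain ⟨n, hn, hr, hs⟩ := exists_first_difference hq hrs
  have h1 := (hπ r (n + 1)).2
  have h2 := (hπ s (n + 1)).1
  rw [res_succ, hr, hn] at h1
  rw [res_succ, hs] at h2
  exact h1.trans_lt ((hsep _).trans_le h2)

end LimitActions

/-! ### Borelness of the limits and inheritance of stratifications -/

section Main

open Set Filter Topology PiNat

variable {Γ X : Type*} [Group Γ]

theorem IsStratification.monotone {E : Setoid X} {F : ℝ → Setoid X} (hF : IsStratification E F) :
    Monotone F := by
  intro r s hrs
  rcases hrs.eq_or_lt with rfl | h
  · exact le_rfl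
  · intro x y hxy
    exact (hF.ssubset r s h x).1 hxy

theorem measurable_act_of_eventually [MeasurableSpace X] {C : Set X} (hC : MeasurableSet C)
    {B : ℕ → MulAction Γ X} (hB : ∀ n, IsBorelAct (B n)) {a₀ : MulAction Γ X} (ha₀ : IsBorelAct a₀)
    {a : MulAction Γ X}
    (h1 : ∀ x ∈ C, ∀ γ, ∀ᶠ n in atTop, act (B n) γ x = act a γ x)
    (h2 : ∀ x ∉ C, ∀ γ, act a γ x = act a₀ γ x) : IsBorelAct a := by
  intro γ S hS
  have : act a γ ⁻¹' S = (C ∩ ⋃ m : ℕ, ⋂ n ≥ m, act (B n) γ ⁻¹' S) ∪ (Cᶜ ∩ act a₀ γ ⁻¹' S) := by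
    ext x
    by_cases hx : x ∈ C
    · simp only [mem_preimage, mem_union, mem_inter_iff, hx, true_and, mem_compl_iff,
        not_true_eq_false, false_and, or_false, mem_iUnion, mem_iInter]
      rw [← eventually_atTop (p := fun n => act (B n) γ x ∈ S)]
      constructor
      · intro h
        filter_upwards [h1 x hx γ] with n hn
        rwa [hn]
      · intro h
        obtain ⟨n, hn, hn'⟩ := (h.and (h1 x hx γ)).exists
        rwa [← hn']
    · simp [hx, h2 x hx γ]
  rw [this]
  exact (hC.inter (MeasurableSet.iUnion fun m => MeasurableSet.biInter (to_countable _)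
    fun n _ => hB n γ hS)).union (hC.compl.inter (ha₀ γ hS))

/-- At each depth only countably many words occur, each on a Borel set of parameters, so the
approximating graphs are Borel in r; on `C` the limit graph is their lim inf. -/
theorem isBorelActSeq_of_eventually [TopologicalSpace X] [PolishSpace X] [MeasurableSpace X]
    [BorelSpace X] [Countable Γ] [MeasurableSpace Γ] [DiscreteMeasurableSpace Γ]
    {C : Set X} (hC : MeasurableSet C) (q : ℕ → ℚ) {B : List Bool → MulAction Γ X}
    (hB : ∀ v, IsBorelAct (B v)) {a₀ : MulAction Γ X} (ha₀ : IsBorelAct a₀)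
    {a : ℝ → MulAction Γ X}
    (h1 : ∀ r, ∀ x ∈ C, ∀ γ, ∀ᶠ n in atTop, act (B (res (cut q r) n)) γ x = act (a r) γ x)
    (h2 : ∀ r, ∀ x ∉ C, ∀ γ, act (a r) γ x = act a₀ γ x) : IsBorelActSeq a := by
  have hG : ∀ b : MulAction Γ X, IsBorelAct b →
      MeasurableSet {p : ℝ × ((Γ × X) × X) | act b p.2.1.1 p.2.1.2 = p.2.2} := by
    intro b hb
    have hm : Measurable fun p : Γ × X => act b p.1 p.2 :=
      measurable_from_prod_countable_right fun γ => hb γ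
    exact measurableSet_eq_fun (hm.comp (measurable_fst.comp measurable_snd))
      (measurable_snd.comp measurable_snd)
  have hGn : ∀ n, MeasurableSet {p : ℝ × ((Γ × X) × X) |
      act (B (res (cut q p.1) n)) p.2.1.1 p.2.1.2 = p.2.2} := by
    intro n
    have : {p : ℝ × ((Γ × X) × X) | act (B (res (cut q p.1) n)) p.2.1.1 p.2.1.2 = p.2.2} =
        ⋃ v : List Bool, Prod.fst ⁻¹' {r : ℝ | res (cut q r) n = v} ∩
          {p | act (B v) p.2.1.1 p.2.1.2 = p.2.2} := by
      ext p
      simp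
    rw [this]
    exact MeasurableSet.iUnion fun v =>
      (measurable_fst (measurableSet_res_cut_eq q n v)).inter (hG _ (hB v))
  have hCm : MeasurableSet {p : ℝ × ((Γ × X) × X) | p.2.1.2 ∈ C} :=
    (measurable_snd.comp (measurable_fst.comp measurable_snd)) hC
  have : {p : ℝ × ((Γ × X) × X) | act (a p.1) p.2.1.1 p.2.1.2 = p.2.2} =
      ({p | p.2.1.2 ∈ C} ∩ ⋃ m : ℕ, ⋂ n ≥ m,
        {p | act (B (res (cut q p.1) n)) p.2.1.1 p.2.1.2 = p.2.2}) ∪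
      ({p | p.2.1.2 ∈ C}ᶜ ∩ {p | act a₀ p.2.1.1 p.2.1.2 = p.2.2}) := by
    ext ⟨r, ⟨γ, x⟩, y⟩
    by_cases hx : x ∈ C
    · simp only [mem_union, mem_inter_iff, hx, true_and, mem_compl_iff, mem_ofPred_eq,
        not_true_eq_false, false_and, or_false, mem_iUnion, mem_iInter]
      rw [← eventually_atTop (p := fun n => act (B (res (cut q r) n)) γ x = y)]
      constructor
      · intro h
        filter_upwards [h1 r x hx γ] with n hn
        rwa [hn]
      · intro h
        obtain ⟨n, hn, hn'⟩ := (h.and (h1 r x hx γ)).exists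
        rw [← hn', hn]
    · simp [hx, h2 r x hx γ]
  rw [IsBorelActSeq, this]
  exact (hCm.inter (MeasurableSet.iUnion fun m => MeasurableSet.biInter (to_countable _)
    fun n _ => hGn n)).union (hCm.compl.inter (hG _ ha₀))

/-- Restricting to an invariant set and reindexing along a strictly increasing function preserves
`μ`-stratifications. -/
theorem IsMuStratification.restr_comp [MeasurableSpace X] {μ : Measure X} {E : Setoid X}
    {F : ℝ → Setoid X} (hF : IsMuStratification μ E F) {C : Set X} (hC : MeasurableSet C)
    (hCE : IsInvariant E C) {π : ℝ → ℝ} (hπ : StrictMono π) :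
    IsMuStratification (μ.comap (Subtype.val : C → X)) (restr E C)
      (fun r => restr (F (π r)) C) := by
  have hemb := MeasurableEmbedding.subtype_coe hC
  have hcls : ∀ r (x : C), cls (restr (F r) C) x = Subtype.val ⁻¹' cls (F r) x := fun _ _ => rfl
  refine ⟨⟨fun r x y h => hF.sub _ h, fun r s hrs x => ?_⟩, fun B hB hBpos r s hrs => ?_⟩
  · rw [hcls, hcls]
    have h := hF.ssubset _ _ (hπ hrs) x
    refine ⟨preimage_mono h.1, fun h' => h.2 fun y hy => ?_⟩
    exact h' (show (⟨y, hCE x x.2 y (hF.sub _ hy)⟩ : C) ∈ _ from hy)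
  · rw [hemb.comap_apply] at hBpos
    have h := hF.ae_ssubset _ (hemb.measurableSet_image.2 hB) hBpos _ _ (hπ hrs)
    rw [ae_restrict_iff' (hemb.measurableSet_image.2 hB)] at h
    rw [ae_restrict_iff' hB, ae_iff, hemb.comap_apply]
    refine measure_mono_null ?_ (ae_iff.1 h)
    rintro _ ⟨x, hx, rfl⟩ hx'
    refine hx fun hxB => ?_
    have hss := hx' (mem_image_of_mem _ hxB)
    rw [hcls, hcls]
    refine ⟨fun y hy => ⟨(hss.1 ⟨hy.1, mem_image_of_mem _ hy.2⟩).1, hy.2⟩, fun h' => hss.2 ?_⟩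
    rintro _ ⟨hy, y, hyB, rfl⟩
    exact ⟨(h' ⟨hy, hyB⟩).1, mem_image_of_mem _ hyB⟩

end Main

end BorelStrat

/-! ### Assembly of the theorem -/

open Set Filter Topology PiNat BorelStrat

theorem mainTheorem11
    {X : Type*} [TopologicalSpace X] [PolishSpace X] [MeasurableSpace X] [BorelSpace X]
    {Γ : Type*} [Group Γ] [Countable Γ] [MeasurableSpace Γ] [DiscreteMeasurableSpace Γ]
    (E : Setoid X) (hE : BorelStrat.IsCountableBorel E)
    (μ : Measure X) [IsProbabilityMeasure μ]
    (F : ℝ → Setoid X) (hF : BorelStrat.IsMuStratification μ E F)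
    (hFborel : BorelStrat.IsBorelRelSeq F)
    (hFgen : ∀ r, ∃ a : MulAction Γ X,
      BorelStrat.IsFreeAct a ∧ BorelStrat.IsBorelAct a ∧ BorelStrat.orb a = F r) :
    ∃ (a : ℝ → MulAction Γ X) (π : ℝ → ℝ) (C : Set X),
      -- a Borel sequence of free Borel actions on all of `X`
      BorelStrat.IsBorelActSeq a ∧
      (∀ r, BorelStrat.IsFreeAct (a r) ∧ BorelStrat.IsBorelAct (a r)) ∧
      -- generating an increasing sequence of subequivalence relations of `E` on all of `X`
      (∀ r, BorelStrat.orb (a r) ≤ E) ∧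
      (∀ r s : ℝ, r < s → BorelStrat.orb (a r) ≤ BorelStrat.orb (a s)) ∧
      -- `C` is an `E`-invariant conull Borel set, on which we have a `μ`-stratification
      MeasurableSet C ∧ BorelStrat.IsInvariant E C ∧ μ Cᶜ = 0 ∧
      BorelStrat.IsMuStratification (μ.comap (Subtype.val : C → X)) (BorelStrat.restr E C)
        (fun r => BorelStrat.restr (BorelStrat.orb (a r)) C) ∧
      -- and on which the `r`-th action generates `F (π r)`
      Measurable π ∧
      (∀ r, BorelStrat.restr (BorelStrat.orb (a r)) C = BorelStrat.restr (F (π r)) C) := by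
  classical
  choose A hAfree hAborel hAorb using hFgen
  have hFE : ∀ r, F r ≤ E := hF.sub
  have hFmono := hF.toIsStratification.monotone
  have hAE : ∀ r, orb (A r) ≤ E := fun r => (hAorb r).le.trans (hFE r)
  obtain ⟨γ, hγ⟩ := exists_surjective_nat Γ
  obtain ⟨q, hq⟩ := exists_surjective_nat ℚ
  obtain ⟨ν, hνfin, hμν, hνsat⟩ := hE.exists_quasiInvariant μ
  obtain ⟨h, hh, hhE, hhx⟩ := hE.exists_ae_enumeration ν
  let P : ℝ → ℕ → ℕ → Set X := fun r k j => {x | act (A r) (γ k) x = h j x}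
  have hP : ∀ r k j, MeasurableSet (P r k j) := fun r k j =>
    measurableSet_eq_fun (hAborel r (γ k)) (hh j)
  -- Stability of the first kind of code makes the actions converge; stability of the second kind
  -- prevents orbits from shrinking in the limit.
  let f : ℝ → ℕ ⊕ ℕ → X → ℕ := fun r => Sum.elim (fun k => firstIndex fun j => P r k j)
    (fun j => firstIndex fun k => P r k j)
  have hf : ∀ r m, Measurable (f r m) := by
    rintro r (k | j)
    · exact measurable_firstIndex fun j => hP r k j
    · exact measurable_firstIndex fun k => hP r k j
  obtain ⟨l, u, hlu, hl, hu, hsep, hconst⟩ := exists_interval_scheme_ae ν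
    (fun r m => f r (Equiv.natSumNatEquivNat.symm m)) fun r m => hf r _
  obtain ⟨C, hCm, hCE, hCν, hCP⟩ := exists_invariant_conull hνsat (hhx.and hconst)
  obtain ⟨π, hπ, hπlu⟩ := exists_strictMono_of_scheme hq hlu hl hu hsep
  have hconst' : ∀ x ∈ C, ∀ m r, ∃ n₀, ∀ n ≥ n₀,
      f (l (res (cut q r) n)) m x = f (l (res (cut q r) n₀)) m x ∧
      f (u (res (cut q r) n)) m x = f (l (res (cut q r) n)) m x := by
    intro x hx m r
    obtain ⟨n₀, hn₀⟩ := (hCP x hx).2 (Equiv.natSumNatEquivNat m)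
    simp only [Equiv.symm_apply_apply] at hn₀
    refine ⟨n₀, fun n hn => ⟨?_, (hn₀ _ (by rwa [res_length])).1.symm⟩⟩
    induction n, hn using Nat.le_induction with
    | base => rfl
    | succ n hn ih => rw [res_succ, (hn₀ _ (by rwa [res_length])).2, ih]
  have hconv : ∀ r, ∀ x ∈ C, ∀ δ,
      ∃ y, ∀ᶠ n in atTop, act (A (l (res (cut q r) n))) δ x = y := by
    intro r x hx δ
    obtain ⟨k, rfl⟩ := hγ δ
    obtain ⟨n₀, hn₀⟩ := hconst' x hx (Sum.inl k) r
    obtain ⟨j, hj⟩ := (hCP x hx).1 _ (hAE (l (res (cut q r) n₀)) (orb_iff.2 ⟨γ k, rfl⟩))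
    obtain ⟨i, hi⟩ := exists_firstIndex_eq (S := fun j => P (l (res (cut q r) n₀)) k j)
      (x := x) ⟨j, hj.symm⟩
    refine ⟨h i x, eventually_atTop.2 ⟨n₀, fun n hn => ?_⟩⟩
    exact mem_of_firstIndex_eq (S := fun j => P (l (res (cut q r) n)) k j)
      ((hn₀ n hn).1.trans hi)
  choose a ha ha' using fun r => exists_limit_action hCE
    (B := fun n => A (l (res (cut q r) n))) (fun n => hAE _) (hAE 0) (hconv r)
  have horb : ∀ r, ∀ x ∈ C, ∀ y, (orb (a r)).r x y ↔ (F (π r)).r x y := by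
    intro r x hx y
    constructor
    · intro hxy
      obtain ⟨δ, rfl⟩ := orb_iff.1 hxy
      obtain ⟨n, hn⟩ := (ha r x hx δ).exists
      have h1 : (F (l (res (cut q r) n))).r x (act (a r) δ x) := by
        rw [← hAorb]
        exact orb_iff.2 ⟨δ, hn⟩
      exact hFmono (hπlu r n).1 h1
    · intro hxy
      obtain ⟨j, rfl⟩ := (hCP x hx).1 y (hFE _ hxy)
      obtain ⟨n₀, hn₀⟩ := hconst' x hx (Sum.inr j) r
      -- The upper endpoint supplies a group element carrying x to h_j(x); as the code agrees at
      -- both endpoints and is stable, one element works at all later lower endpoints.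
      have h1 : (F (u (res (cut q r) n₀))).r x (h j x) := hFmono (hπlu r n₀).2 hxy
      rw [← hAorb] at h1
      obtain ⟨δ, hδ⟩ := orb_iff.1 h1
      obtain ⟨k, rfl⟩ := hγ δ
      obtain ⟨i, hi⟩ := exists_firstIndex_eq (S := fun k => P (u (res (cut q r) n₀)) k j)
        (x := x) ⟨k, hδ⟩
      have hev : ∀ n ≥ n₀, act (A (l (res (cut q r) n))) (γ i) x = h j x := fun n hn =>
        mem_of_firstIndex_eq (S := fun k => P (l (res (cut q r) n)) k j)
          ((hn₀ n hn).1.trans ((hn₀ n₀ le_rfl).2.symm.trans hi))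
      obtain ⟨n, hn, hn'⟩ := ((ha r x hx (γ i)).and (eventually_ge_atTop n₀)).exists
      exact orb_iff.2 ⟨γ i, hn.symm.trans (hev n hn')⟩
  have horb' : ∀ r, ∀ x ∉ C, ∀ y, (orb (a r)).r x y ↔ (orb (A 0)).r x y := by
    intro r x hx y
    simp only [orb_iff, ha' r x hx]
  have hrestr : ∀ r, restr (orb (a r)) C = restr (F (π r)) C := fun r =>
    Setoid.ext fun x y => horb r x x.2 y
  refine ⟨a, π, C, ?_, fun r => ⟨?_, ?_⟩, fun r x y hxy => ?_, fun r s hrs x y hxy => ?_, hCm, hCE,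
    hμν hCν, ?_, hπ.monotone.measurable, hrestr⟩
  · exact isBorelActSeq_of_eventually hCm q (fun v => hAborel (l v)) (hAborel 0) ha ha'
  · intro δ x hδ
    by_cases hx : x ∈ C
    · obtain ⟨n, hn⟩ := (ha r x hx δ).exists
      exact hAfree _ δ x (hn.trans hδ)
    · exact hAfree 0 δ x ((ha' r x hx δ).symm.trans hδ)
  · exact measurable_act_of_eventually hCm (fun n => hAborel _) (hAborel 0) (ha r) (ha' r)
  · by_cases hx : x ∈ C
    · exact hFE _ ((horb r x hx y).1 hxy)
    · exact hAE 0 ((horb' r x hx y).1 hxy)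
  · by_cases hx : x ∈ C
    · exact (horb s x hx y).2 (hFmono (hπ hrs).le ((horb r x hx y).1 hxy))
    · exact (horb' s x hx y).2 ((horb' r x hx y).1 hxy)
  · simp only [hrestr]
    exact hF.restr_comp hCm hCE hπ
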